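/- Let $n\ge 2$, let $\Omega\subset\mathbb R^n$ be a domain (a nonempty connected open set), let $q\in(1,\infty)$ and $a\in\mathbb R$ with $(1-\frac1q)a\ge 1$ (so $a>0$), and let $f\in W^{2,q}(\Omega,\mathbb R^n)$, i.e. $f$ and its weak derivatives of first and second order belong to $L^q(\Omega)$. Let $Df$ be the precise representative of the weak gradient, defined entry by entry by $Df(x)=\limsup_{r\to0+}\frac1{|B(x,r)|}\int_{B(x,r)}Df(y)\,dy$ for $x\in\Omega$ (an entry whose upper limit is infinite is given the value $0$), and let $J_f(x)=\det Df(x)$ be the determinant of this representative. Assume that $|J_f|^{-a}\in L^1(\Omega)$, where $|J_f|^{-a}=\infty$ on $\{J_f=0\}$. Then for every affine hyperplane $P\subset\mathbb R^n$ with orthogonal projection $\pi:\mathbb R^n\to P$, $$\mathcal H^{n-1}\bigl(\pi(\{x\in\Omega:\ J_f(x)=0\})\bigr)=0 .$$ Moreover, either $J_f>0$ almost everywhere in $\Omega$ or $J_f<0$ almost everywhere in $\Omega$. -/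

import Mathlib

open MeasureTheory Filter Topology
open scoped ENNReal ContDiff

/-- `g` is the weak `i`-th partial derivative of `u` on the open set `Ω ⊆ ℝⁿ`: both are locally
integrable on `Ω`, and `∫ u ∂ᵢφ = -∫ g φ` for every test function `φ ∈ C_c^∞(Ω)`. -/
def IsWeakPartialDeriv {n : ℕ} (Ω : Set (EuclideanSpace ℝ (Fin n))) (i : Fin n)
    (u g : EuclideanSpace ℝ (Fin n) → ℝ) : Prop :=
  LocallyIntegrableOn u Ω volume ∧ LocallyIntegrableOn g Ω volume ∧
    ∀ φ : EuclideanSpace ℝ (Fin n) → ℝ,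
      ContDiff ℝ ∞ φ → HasCompactSupport φ → tsupport φ ⊆ Ω →
        ∫ x in Ω, u x * fderiv ℝ φ x (EuclideanSpace.single i 1) = -∫ x in Ω, g x * φ x

/-- The scalar Sobolev space `W^{k,p}(Ω)`: `W^{0,p}(Ω) = L^p(Ω)`, and `u ∈ W^{k+1,p}(Ω)` if
`u ∈ L^p(Ω)` has weak first partial derivatives, all of them in `W^{k,p}(Ω)`. -/
def MemSobolevW {n : ℕ} (Ω : Set (EuclideanSpace ℝ (Fin n))) (p : ℝ≥0∞) :
    ℕ → (EuclideanSpace ℝ (Fin n) → ℝ) → Prop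
  | 0, u => MemLp u p (volume.restrict Ω)
  | k + 1, u => MemLp u p (volume.restrict Ω) ∧
      ∀ i : Fin n, ∃ g : EuclideanSpace ℝ (Fin n) → ℝ,
        IsWeakPartialDeriv Ω i u g ∧ MemSobolevW Ω p k g

/-- `D` is (a version of) the weak gradient matrix of `f : Ω → ℝⁿ`: its `(i, j)` entry is the weak
`j`-th partial derivative of the `i`-th component of `f`. -/
def IsWeakGradient {n : ℕ} (Ω : Set (EuclideanSpace ℝ (Fin n)))
    (f : EuclideanSpace ℝ (Fin n) → EuclideanSpace ℝ (Fin n))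
    (D : EuclideanSpace ℝ (Fin n) → Matrix (Fin n) (Fin n) ℝ) : Prop :=
  ∀ i j : Fin n, IsWeakPartialDeriv Ω j (fun x => f x i) (fun x => D x i j)

/-- The precise representative `x ↦ limsup_{r → 0+} ⨍_{B(x,r)} g`. The upper limit is taken in
`[-∞, ∞]`; where it is infinite, the representative is given the value `0`. -/
noncomputable def preciseRep {n : ℕ} (g : EuclideanSpace ℝ (Fin n) → ℝ)
    (x : EuclideanSpace ℝ (Fin n)) : ℝ :=
  (limsup (fun r : ℝ => ((⨍ y in Metric.ball x r, g y : ℝ) : EReal)) (𝓝[>] 0)).toReal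

/-- The Jacobian determinant: the determinant of the precise representative (entry by entry) of
the weak gradient `D`. -/
noncomputable def preciseJacobian {n : ℕ}
    (D : EuclideanSpace ℝ (Fin n) → Matrix (Fin n) (Fin n) ℝ)
    (x : EuclideanSpace ℝ (Fin n)) : ℝ :=
  (Matrix.of fun i j => preciseRep (fun y => D y i j) x).det

/-!
On almost every line parallel to a given vector `v`, the precise representative of a function
`u ∈ W^{1,q}` is Hölder continuous with exponent `1 - 1/q`, *at every point of the line*. Indeed
the averages of `u` over balls of radius `r` satisfy
`u_r(x + t v) - u_r(x + s v) = ∫_s^t (∂_v u)_r(x + τ v) dτ`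
(`IsWeakDirDeriv.average_ball_sub`). The integrand is dominated by the maximal function of `∂_v u`,
which is locally integrable because `q > 1` (`exists_measurable_average_le`), hence integrable along
almost every line, and it converges almost everywhere on almost every line by Lebesgue's
differentiation theorem. So the averages converge at all points of such a line as soon as they
converge at one, the limit is a primitive of `∂_v u`, and Hölder's inequality bounds its increments
(`IsWeakDirDeriv.ae_exists_holder_limit`).

Consequently `J = det Df` is locally Hölder continuous with exponent `1 - 1/q` on almost every line
(`exists_holder_det`). If it vanished at a point `t₀` of the line, then `|J|^{-a}` would be at least
a constant times `|t - t₀|^{-1}` near `t₀`, since `(1 - 1/q) a ≥ 1`, and would not be integrable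
along the line (`lintegral_rpow_neg_eq_top_of_holder_zero`). By Fubini's theorem `|J|^{-a}` is
integrable along almost every line; so almost every line misses the zero set of `J`
(`ae_line_continuousOn_preciseJacobian_ne_zero`). For `v` normal to a hyperplane `P`, the union of
the exceptional lines is a null set invariant under translation along `v`, and its projection to `P`
is `ℋ^{n-1}`-null (`hausdorffMeasure_orthogonalProjection_image_eq_zero`).

For the sign, let `B ⊆ Ω` be a ball. For every vector `v` and almost every `x` with `x, x + v ∈ B`,
the continuous function `J` has no zero on the segment from `x` to `x + v`, so it has the same sign
at both ends. By Fubini's theorem some fixed `x` has this property for almost every `v`, which means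
that the sign of `J` is almost everywhere constant on `B` (`ae_mem_or_ae_notMem_of_translation`);
connectedness of `Ω` finishes the argument.
-/

/-! ### The local maximal function -/

section MaximalFunction

variable {E : Type*} [NormedAddCommGroup E] [NormedSpace ℝ E] [FiniteDimensional ℝ E]
  [MeasurableSpace E] [BorelSpace E] (μ : Measure E) [μ.IsAddHaarMeasure]

/-- Jensen's inequality for `t ↦ t ^ q`, in a form without division: if the average of `h` over `s`
is at least `c`, then the average of `h ^ q` is at least `c ^ q`. -/
theorem rpow_mul_measure_le_lintegral_rpow {α : Type*} [MeasurableSpace α] {ν : Measure α}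
    {h : α → ℝ≥0∞} (hm : AEMeasurable h ν) {q : ℝ} (hq : 1 < q) {c : ℝ≥0∞} {s : Set α}
    (h0 : ν s ≠ 0) (hs : ν s ≠ ⊤) (hc : c * ν s ≤ ∫⁻ y in s, h y ∂ν) :
    c ^ q * ν s ≤ ∫⁻ y in s, h y ^ q ∂ν := by
  have hq0 : 0 < q := by linarith
  have hpq : q.HolderConjugate (q / (q - 1)) := Real.HolderConjugate.conjExponent hq
  have H := ENNReal.lintegral_mul_le_Lp_mul_Lq (ν.restrict s) hpq hm.restrict
    (aemeasurable_const (b := (1 : ℝ≥0∞)))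
  simp only [Pi.mul_apply, mul_one, ENNReal.one_rpow, lintegral_const,
    Measure.restrict_apply MeasurableSet.univ, Set.univ_inter, one_mul] at H
  have H2 := ENNReal.rpow_le_rpow (hc.trans H) hq0.le
  rw [ENNReal.mul_rpow_of_nonneg _ _ hq0.le, ENNReal.mul_rpow_of_nonneg _ _ hq0.le,
    ← ENNReal.rpow_mul, ← ENNReal.rpow_mul, one_div_mul_cancel hq0.ne', ENNReal.rpow_one] at H2
  have e1 : 1 / (q / (q - 1)) * q = q - 1 := by
    have : q - 1 ≠ 0 := by linarith
    field_simp
  have e2 : ν s ^ q = ν s * ν s ^ (q - 1) := by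
    conv_rhs => rw [← ENNReal.rpow_one (ν s), ← ENNReal.rpow_mul]
    rw [← ENNReal.rpow_add _ _ h0 hs]; congr 1; ring
  rw [e1, e2, ← mul_assoc] at H2
  have h1 : ν s ^ (q - 1) ≠ 0 := by simp [ENNReal.rpow_eq_zero_iff, h0, hs]
  have h2 : ν s ^ (q - 1) ≠ ⊤ := ENNReal.rpow_ne_top_of_nonneg (by linarith) hs
  exact (ENNReal.mul_le_mul_iff_left h1 h2).1 H2

/-- Weak type `(q, q)` estimate for the maximal function over balls of radius less than `1`. It follows
from the Vitali covering lemma applied to balls on which the average of `h`, hence that of `h ^ q`,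
is large. -/
theorem rpow_mul_measure_average_gt_le {h : E → ℝ≥0∞} (hm : AEMeasurable h μ) {q : ℝ}
    (hq : 1 < q) (c : ℝ≥0∞) :
    c ^ q * μ {x | ∃ r ∈ Set.Ioo (0 : ℝ) 1,
      c * μ (Metric.ball x r) < ∫⁻ y in Metric.ball x r, h y ∂μ}
      ≤ 4 ^ Module.finrank ℝ E * ∫⁻ y, h y ^ q ∂μ := by
  set t : Set (E × ℝ) := {p | p.2 ∈ Set.Ioo (0 : ℝ) 1 ∧
    c * μ (Metric.ball p.1 p.2) < ∫⁻ y in Metric.ball p.1 p.2, h y ∂μ} with ht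
  obtain ⟨u, hut, hdisj, hcov⟩ :=
    Vitali.exists_disjoint_subfamily_covering_enlargement_ball t Prod.fst Prod.snd 1
      (fun a ha => ha.1.2.le) 4 (by norm_num)
  have hcount : u.Countable := hdisj.countable_of_isOpen (fun _ _ => Metric.isOpen_ball)
    (fun a ha => ⟨a.1, Metric.mem_ball_self (hut ha).1.1⟩)
  have hsub : {x | ∃ r ∈ Set.Ioo (0 : ℝ) 1,
      c * μ (Metric.ball x r) < ∫⁻ y in Metric.ball x r, h y ∂μ} ⊆
      ⋃ b ∈ u, Metric.ball b.1 (4 * b.2) := by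
    rintro x ⟨r, hr, hx⟩
    obtain ⟨b, hb, hb'⟩ := hcov (x, r) ⟨hr, hx⟩
    exact Set.mem_biUnion hb (hb' (Metric.mem_ball_self hr.1))
  calc c ^ q * μ {x | ∃ r ∈ Set.Ioo (0 : ℝ) 1,
      c * μ (Metric.ball x r) < ∫⁻ y in Metric.ball x r, h y ∂μ}
      ≤ c ^ q * ∑' b : u, μ (Metric.ball b.1.1 (4 * b.1.2)) := by
        gcongr
        exact (measure_mono hsub).trans (measure_biUnion_le μ hcount _)
    _ = ∑' b : u, 4 ^ Module.finrank ℝ E * (c ^ q * μ (Metric.ball b.1.1 b.1.2)) := by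
        rw [← ENNReal.tsum_mul_left]
        refine tsum_congr fun b => ?_
        have hb := (hut b.2).1.1
        rw [Measure.addHaar_ball_mul_of_pos μ b.1.1 (by norm_num : (0 : ℝ) < 4) b.1.2,
          Measure.addHaar_ball_center μ b.1.1, ENNReal.ofReal_pow (by norm_num)]
        norm_num
        ring
    _ ≤ ∑' b : u, 4 ^ Module.finrank ℝ E * ∫⁻ y in Metric.ball b.1.1 b.1.2, h y ^ q ∂μ := by
        gcongr with b
        exact rpow_mul_measure_le_lintegral_rpow hm hq
          (Metric.measure_ball_pos μ _ (hut b.2).1.1).ne' measure_ball_lt_top.ne (hut b.2).2.le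
    _ = 4 ^ Module.finrank ℝ E * ∫⁻ y in ⋃ b ∈ u, Metric.ball b.1 b.2, h y ^ q ∂μ := by
        rw [ENNReal.tsum_mul_left, lintegral_biUnion hcount (fun _ _ => measurableSet_ball) hdisj]
    _ ≤ _ := by
        gcongr
        exact Measure.restrict_le_self

/-- The averages of an `L^q` function over balls of radius less than `1` have a locally integrable
majorant. The majorant `1 + ∑ₖ 2 ^ (k + 1) 1_{Tₖ}`, where `Tₖ` is a measurable hull of the set on
which the maximal function exceeds `2 ^ k`, replaces the maximal function itself, so that no
measurability of the latter is needed. -/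
theorem exists_measurable_average_le {h : E → ℝ≥0∞} (hm : AEMeasurable h μ) {q : ℝ}
    (hq : 1 < q) (hfin : ∫⁻ y, h y ^ q ∂μ ≠ ⊤) :
    ∃ G : E → ℝ≥0∞, Measurable G ∧
      (∀ x, ∀ r ∈ Set.Ioo (0 : ℝ) 1,
        ∫⁻ y in Metric.ball x r, h y ∂μ ≤ G x * μ (Metric.ball x r)) ∧
      ∀ K : Set E, μ K ≠ ⊤ → ∫⁻ x in K, G x ∂μ < ⊤ := by
  set A : ℕ → Set E := fun k => {x | ∃ r ∈ Set.Ioo (0 : ℝ) 1,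
      (2 : ℝ≥0∞) ^ k * μ (Metric.ball x r) < ∫⁻ y in Metric.ball x r, h y ∂μ} with hA
  set T : ℕ → Set E := fun k => toMeasurable μ (A k)
  have hTm : ∀ k, MeasurableSet (T k) := fun k => measurableSet_toMeasurable _ _
  have hGm : ∀ k, Measurable ((T k).indicator fun _ => (2 : ℝ≥0∞) ^ (k + 1)) := fun k =>
    measurable_const.indicator (hTm k)
  refine ⟨fun x => 1 + ∑' k, (T k).indicator (fun _ => (2 : ℝ≥0∞) ^ (k + 1)) x,
    measurable_const.add (Measurable.tsum hGm), ?_, ?_⟩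
  · intro x r hr
    by_contra! hlt
    -- If the average exceeds `g`, then inductively it exceeds every `2 ^ k`: it exceeds `1`, and if
    -- it exceeds `2 ^ k`, then `x ∈ T k`, so that `g ≥ 2 ^ (k + 1)`. Hence `g = ∞`.
    set g := 1 + ∑' k, (T k).indicator (fun _ => (2 : ℝ≥0∞) ^ (k + 1)) x
    have hstep : ∀ k, (2 : ℝ≥0∞) ^ k ≤ g := by
      intro k
      induction k with
      | zero => simp [g]
      | succ k ih =>
        have : x ∈ T k := subset_toMeasurable _ _ ⟨r, hr, lt_of_le_of_lt (by gcongr) hlt⟩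
        refine le_trans ?_ (le_add_self)
        refine le_trans ?_ (ENNReal.le_tsum k)
        simp [this]
    have htop : g = ⊤ := by
      exact top_le_iff.1 (le_of_tendsto'
        (ENNReal.tendsto_pow_atTop_nhds_top_iff.2 (by norm_num : (1 : ℝ≥0∞) < 2)) hstep)
    rw [htop, ENNReal.top_mul (Metric.measure_ball_pos μ _ hr.1).ne'] at hlt
    exact not_top_lt hlt
  · intro K hK
    rw [lintegral_add_left measurable_const, lintegral_tsum (fun k => (hGm k).aemeasurable)]
    refine ENNReal.add_lt_top.2 ⟨by simpa using hK.lt_top, ?_⟩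
    set C := 4 ^ Module.finrank ℝ E * ∫⁻ y, h y ^ q ∂μ
    have hC : C ≠ ⊤ := ENNReal.mul_ne_top (by simp) hfin
    have hT : ∀ k, ∫⁻ x in K, (T k).indicator (fun _ => (2 : ℝ≥0∞) ^ (k + 1)) x ∂μ ≤
        2 * C * ((2 : ℝ≥0∞) ^ (1 - q)) ^ k := by
      intro k
      calc _ ≤ ∫⁻ x, (T k).indicator (fun _ => (2 : ℝ≥0∞) ^ (k + 1)) x ∂μ :=
            setLIntegral_le_lintegral _ _
        _ = 2 ^ (k + 1) * μ (A k) := by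
            rw [lintegral_indicator_const (hTm k), measure_toMeasurable]
        _ = 2 * ((2 : ℝ≥0∞) ^ (1 - q)) ^ k * (((2 : ℝ≥0∞) ^ k) ^ q * μ (A k)) := by
            have : (2 : ℝ≥0∞) ^ (k + 1) =
                2 * ((2 : ℝ≥0∞) ^ (1 - q)) ^ k * ((2 : ℝ≥0∞) ^ k) ^ q := by
              rw [pow_succ', mul_assoc]
              congr 1
              rw [← ENNReal.rpow_natCast, ← ENNReal.rpow_natCast, ← ENNReal.rpow_mul,
                ← ENNReal.rpow_mul, ← ENNReal.rpow_add _ _ (by norm_num) (by norm_num)]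
              congr 1; ring
            rw [this]; ring
        _ ≤ 2 * ((2 : ℝ≥0∞) ^ (1 - q)) ^ k * C := by
            gcongr
            exact rpow_mul_measure_average_gt_le μ hm hq _
        _ = _ := by ring
    refine (ENNReal.tsum_le_tsum hT).trans_lt ?_
    rw [ENNReal.tsum_mul_left, ENNReal.tsum_geometric]
    refine ENNReal.mul_lt_top (ENNReal.mul_lt_top (by simp) hC.lt_top) ?_
    rw [ENNReal.inv_lt_top, tsub_pos_iff_lt]
    exact ENNReal.rpow_lt_one_of_one_lt_of_neg (by norm_num) (by linarith)

end MaximalFunction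

/-! ### Averages over balls and weak directional derivatives -/

section BallIntegrals

variable {E : Type*} [NormedAddCommGroup E] [InnerProductSpace ℝ E]

/-- A smooth bump supported in the open ball of radius `r` about `0` and equal to `1` on the closed
ball of radius `r (1 - 1 / (k + 2))`. For `k → ∞` these converge pointwise to the indicator of the
open ball. The shift by `2` keeps the inner radius positive. -/
noncomputable def ballBump (E : Type*) [NormedAddCommGroup E] (r : ℝ) (hr : 0 < r) (k : ℕ) :
    ContDiffBump (0 : E) where
  rIn := r * (1 - 1 / (k + 2))
  rOut := r
  rIn_pos := by
    have : 1 / ((k : ℝ) + 2) < 1 := by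
      rw [div_lt_one (by positivity)]; linarith [(Nat.cast_nonneg k : (0 : ℝ) ≤ k)]
    exact mul_pos hr (by linarith)
  rIn_lt_rOut := by
    have : 0 < 1 / ((k : ℝ) + 2) := by positivity
    nlinarith

theorem tendsto_ballBump {r : ℝ} (hr : 0 < r) (y : E) :
    Tendsto (fun k => ballBump E r hr k y) atTop
      (𝓝 ((Metric.ball 0 r).indicator (fun _ => 1) y)) := by
  by_cases hy : y ∈ Metric.ball 0 r
  · rw [Set.indicator_of_mem hy]
    have h1 : Tendsto (fun k : ℕ => r * (1 - 1 / ((k : ℝ) + 2))) atTop (𝓝 (r * (1 - 0))) := by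
      refine (Tendsto.const_sub 1 ?_).const_mul r
      have := tendsto_one_div_add_atTop_nhds_zero_nat (𝕜 := ℝ)
      have h := (tendsto_add_atTop_iff_nat 1).2 this
      refine h.congr fun k => ?_
      push_cast; ring
    rw [sub_zero, mul_one] at h1
    refine tendsto_const_nhds.congr' ?_
    filter_upwards [h1.eventually_const_lt (mem_ball_zero_iff.1 hy)] with k hk
    exact ((ballBump E r hr k).one_of_mem_closedBall (mem_closedBall_zero_iff.2 hk.le)).symm
  · rw [Set.indicator_of_notMem hy]
    refine tendsto_const_nhds.congr fun k => ?_
    refine ((ballBump E r hr k).zero_of_le_dist ?_).symm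
    simpa [ballBump] using hy

theorem norm_mul_ballBump_le {r : ℝ} (hr : 0 < r) (U : E → ℝ) (x z : E) (k : ℕ) :
    ‖U z * ballBump E r hr k (x - z)‖ ≤ (Metric.ball x r).indicator (fun z => ‖U z‖) z := by
  by_cases hz : z ∈ Metric.ball x r
  · rw [Set.indicator_of_mem hz, norm_mul, Real.norm_of_nonneg (ContDiffBump.nonneg _)]
    exact mul_le_of_le_one_right (norm_nonneg _) (ContDiffBump.le_one _)
  · rw [Set.indicator_of_notMem hz, (ballBump E r hr k).zero_of_le_dist, mul_zero, norm_zero]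
    rw [Metric.mem_ball, dist_comm, dist_eq_norm] at hz
    simpa [ballBump] using hz

variable [FiniteDimensional ℝ E] [MeasurableSpace E] [BorelSpace E]

/-- `G` is the weak derivative of `U` in the direction `v` on the open set `Ω`. The integrals are over
the whole space: `U` and `G` are meant to be extended by zero outside `Ω`, which makes them locally
integrable everywhere, so that averages over arbitrary balls make sense. -/
def IsWeakDirDeriv (Ω : Set E) (v : E) (U G : E → ℝ) : Prop :=
  ∀ φ : E → ℝ, ContDiff ℝ ∞ φ → HasCompactSupport φ → tsupport φ ⊆ Ω →
    ∫ z, U z * fderiv ℝ φ z v = -∫ z, G z * φ z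

/-- Differentiating a mollification along `v` moves the derivative to the weak derivative: the
translated and reflected bump is the test function. -/
theorem IsWeakDirDeriv.hasDerivAt_integral_bump {Ω : Set E} {v : E} {U G : E → ℝ}
    (hw : IsWeakDirDeriv Ω v U G) (hU : LocallyIntegrable U volume) (χ : ContDiffBump (0 : E))
    {x : E} {τ : ℝ} (hx : Metric.closedBall (x + τ • v) χ.rOut ⊆ Ω) :
    HasDerivAt (fun τ : ℝ => ∫ z, U z * χ (x + τ • v - z))
      (∫ z, G z * χ (x + τ • v - z)) τ := by
  have h1 := χ.hasCompactSupport.hasFDerivAt_convolution_right (ContinuousLinearMap.mul ℝ ℝ) hU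
    (χ.contDiff (n := 1)) (x + τ • v)
  have h2 : HasDerivAt (fun τ : ℝ => x + τ • v) v τ := by
    simpa using ((hasDerivAt_id τ).smul_const v).const_add x
  have h3 := h1.comp_hasDerivAt τ h2
  rw [convolution_precompR_apply _ hU (χ.hasCompactSupport.fderiv ℝ)
    ((χ.contDiff (n := 1)).continuous_fderiv one_ne_zero)] at h3
  have h4 := hw (fun z => χ (x + τ • v - z))
    (χ.contDiff.comp (contDiff_const.sub contDiff_id))
    (χ.hasCompactSupport.comp_homeomorph (Homeomorph.subLeft (x + τ • v)))
    (by
      refine subset_trans (closure_minimal ?_ Metric.isClosed_closedBall) hx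
      intro z hz
      have : x + τ • v - z ∈ Function.support χ := hz
      rw [χ.support_eq, mem_ball_zero_iff] at this
      rw [Metric.mem_closedBall, dist_comm, dist_eq_norm]
      exact this.le)
  have h5 : ∀ z, fderiv ℝ (fun z => χ (x + τ • v - z)) z v =
      - fderiv ℝ χ (x + τ • v - z) v := by
    intro z
    have hd : HasFDerivAt χ (fderiv ℝ χ (x + τ • v - z)) (x + τ • v - z) :=
      ((χ.contDiff (n := 1)).differentiable one_ne_zero _).hasFDerivAt
    have := hd.comp z ((hasFDerivAt_id z).const_sub (x + τ • v))
    rw [show (fun z => χ (x + τ • v - z)) = χ ∘ fun z => x + τ • v - z from rfl, this.fderiv]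
    simp
  simp only [h5, mul_neg, integral_neg, neg_inj] at h4
  rw [← h4]
  exact h3

theorem MeasureTheory.LocallyIntegrable.integrableOn_ball {U : E → ℝ}
    (hU : LocallyIntegrable U volume) (x : E) (r : ℝ) : IntegrableOn U (Metric.ball x r) :=
  (hU.integrableOn_isCompact (isCompact_closedBall x r)).mono_set Metric.ball_subset_closedBall

theorem tendsto_integral_ballBump {U : E → ℝ} (hU : LocallyIntegrable U volume) {r : ℝ}
    (hr : 0 < r) (x : E) :
    Tendsto (fun k => ∫ z, U z * ballBump E r hr k (x - z)) atTop
      (𝓝 (∫ z in Metric.ball x r, U z)) := by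
  rw [← integral_indicator measurableSet_ball]
  refine tendsto_integral_of_dominated_convergence
    ((Metric.ball x r).indicator (fun z => ‖U z‖)) (fun k => ?_) ?_ (fun k => ?_) ?_
  · refine hU.aestronglyMeasurable.mul (Continuous.aestronglyMeasurable ?_)
    exact (ContDiffBump.continuous _).comp (by fun_prop)
  · exact (integrable_indicator_iff measurableSet_ball).2 (hU.integrableOn_ball x r).norm
  · exact ae_of_all _ fun z => norm_mul_ballBump_le hr U x z k
  · refine ae_of_all _ fun z => ?_
    have := (tendsto_ballBump hr (x - z)).const_mul (U z)
    refine this.trans (le_of_eq (congrArg 𝓝 ?_))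
    symm
    by_cases hz : z ∈ Metric.ball x r
    · have h' : x - z ∈ Metric.ball 0 r := by
        rw [Metric.mem_ball, dist_comm, dist_eq_norm] at hz
        simpa using hz
      rw [Set.indicator_of_mem hz, Set.indicator_of_mem h', mul_one]
    · have h' : x - z ∉ Metric.ball 0 r := by
        rw [Metric.mem_ball, dist_comm, dist_eq_norm] at hz
        simpa using hz
      rw [Set.indicator_of_notMem hz, Set.indicator_of_notMem h', mul_zero]

theorem continuous_integral_bump {U : E → ℝ} (hU : LocallyIntegrable U volume)
    (χ : ContDiffBump (0 : E)) : Continuous fun x => ∫ z, U z * χ (x - z) :=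
  χ.hasCompactSupport.continuous_convolution_right (ContinuousLinearMap.mul ℝ ℝ) hU χ.continuous

theorem stronglyMeasurable_integral_ball {U : E → ℝ} (hU : LocallyIntegrable U volume) (r : ℝ) :
    StronglyMeasurable fun x => ∫ z in Metric.ball x r, U z := by
  rcases le_or_gt r 0 with hr | hr
  · simp only [Metric.ball_eq_empty.2 hr, Measure.restrict_empty, integral_zero_measure]
    exact stronglyMeasurable_const
  · exact stronglyMeasurable_of_tendsto atTop
      (fun k => (continuous_integral_bump hU (ballBump E r hr k)).stronglyMeasurable)
      (tendsto_pi_nhds.2 fun x => tendsto_integral_ballBump hU hr x)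

/-- The fundamental theorem of calculus for integrals over moving balls; it is the limit of the same
formula for smooth bumps in place of the indicator of the ball. -/
theorem IsWeakDirDeriv.integral_ball_sub {Ω : Set E} {v : E} {U G : E → ℝ}
    (hw : IsWeakDirDeriv Ω v U G) (hU : LocallyIntegrable U volume)
    (hG : LocallyIntegrable G volume) {r : ℝ} (hr : 0 < r) {x : E} {s t : ℝ}
    (hx : ∀ τ ∈ Set.uIcc s t, Metric.closedBall (x + τ • v) r ⊆ Ω) :
    (∫ z in Metric.ball (x + t • v) r, U z) - ∫ z in Metric.ball (x + s • v) r, U z =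
      ∫ τ in s..t, ∫ z in Metric.ball (x + τ • v) r, G z := by
  have hcont : ∀ k, Continuous fun τ : ℝ => ∫ z, G z * ballBump E r hr k (x + τ • v - z) :=
    fun k => (continuous_integral_bump hG (ballBump E r hr k)).comp
      (by fun_prop : Continuous fun τ : ℝ => x + τ • v)
  have hk : ∀ k, ∫ τ in s..t, ∫ z, G z * ballBump E r hr k (x + τ • v - z) =
      (∫ z, U z * ballBump E r hr k (x + t • v - z)) -
        ∫ z, U z * ballBump E r hr k (x + s • v - z) := fun k =>
    intervalIntegral.integral_eq_sub_of_hasDerivAt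
      (fun τ hτ => hw.hasDerivAt_integral_bump hU (ballBump E r hr k) (hx τ hτ))
      ((hcont k).intervalIntegrable _ _)
  have hL := (tendsto_integral_ballBump hU hr (x + t • v)).sub
    (tendsto_integral_ballBump hU hr (x + s • v))
  refine tendsto_nhds_unique hL ?_
  simp only [← hk]
  obtain ⟨R, hR⟩ : ∃ R, ∀ τ ∈ Set.uIcc s t, Metric.ball (x + τ • v) r ⊆ Metric.closedBall x R := by
    obtain ⟨R, hR⟩ := ((isCompact_uIcc (a := s) (b := t)).image
      (by fun_prop : Continuous fun τ : ℝ => x + τ • v)).isBounded.subset_closedBall x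
    refine ⟨r + R, fun τ hτ => ?_⟩
    refine Metric.ball_subset_closedBall.trans (Metric.closedBall_subset_closedBall' ?_)
    have := hR ⟨τ, hτ, rfl⟩
    rw [Metric.mem_closedBall] at this
    linarith
  refine intervalIntegral.tendsto_integral_filter_of_dominated_convergence
    (fun _ => ∫ z in Metric.closedBall x R, ‖G z‖) ?_ ?_ ?_ ?_
  · exact Eventually.of_forall fun k => (hcont k).aestronglyMeasurable
  · refine Eventually.of_forall fun k => ae_of_all _ fun τ hτ => ?_
    rw [← integral_indicator measurableSet_closedBall]
    refine norm_integral_le_of_norm_le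
      ((integrable_indicator_iff measurableSet_closedBall).2
        (hG.integrableOn_isCompact (isCompact_closedBall x R)).norm) (ae_of_all _ fun z => ?_)
    refine (norm_mul_ballBump_le hr G (x + τ • v) z k).trans ?_
    exact Set.indicator_le_indicator_of_subset (hR τ (Set.uIoc_subset_uIcc hτ))
      (fun _ => norm_nonneg _) z
  · exact intervalIntegrable_const
  · exact ae_of_all _ fun τ _ => tendsto_integral_ballBump hG hr _

end BallIntegrals

/-! ### Restriction to almost every line -/

section Lines

variable {E : Type*} [NormedAddCommGroup E] [InnerProductSpace ℝ E] [FiniteDimensional ℝ E]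
  [MeasurableSpace E] [BorelSpace E]

/-- A property that holds almost everywhere holds almost everywhere on almost every line parallel to
`v`. Almost every line means: the line `x + ℝ v` for almost every point `x` of the space. -/
theorem ae_ae_line {p : E → Prop} (hp : ∀ᵐ x : E, p x) (v : E) :
    ∀ᵐ x : E, ∀ᵐ t : ℝ, p (x + t • v) := by
  have hm : Measurable fun z : ℝ × E => z.2 + z.1 • v := by fun_prop
  have hq : ∀ᵐ z : E × ℝ, p (z.1 + z.2 • v) := by
    have hs : ∀ᵐ z : ℝ × E, p (z.2 + z.1 • v) := by
      rw [ae_iff] at hp ⊢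
      refine measure_mono_null (t := (fun z : ℝ × E => z.2 + z.1 • v) ⁻¹'
        toMeasurable volume {x | ¬ p x}) (fun z hz => subset_toMeasurable _ _ hz) ?_
      rw [Measure.volume_eq_prod, Measure.measure_prod_null (hm (measurableSet_toMeasurable _ _))]
      refine ae_of_all _ fun t => ?_
      change volume (Prod.mk t ⁻¹' _) = 0
      have : Prod.mk t ⁻¹' ((fun z : ℝ × E => z.2 + z.1 • v) ⁻¹' toMeasurable volume {x | ¬ p x})
          = (fun x => x + t • v) ⁻¹' toMeasurable volume {x | ¬ p x} := rfl
      rw [this, measure_preimage_add_right, measure_toMeasurable, hp]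
    exact (Measure.measurePreserving_swap (μ := (volume : Measure E))
      (ν := (volume : Measure ℝ))).quasiMeasurePreserving.ae hs
  exact Measure.ae_ae_of_ae_prod hq

theorem ae_lintegral_line_lt_top {h : E → ℝ≥0∞} (hm : AEMeasurable h volume)
    (hfin : ∀ R : ℝ, ∫⁻ x in Metric.ball 0 R, h x < ⊤) (v : E) :
    ∀ᵐ x : E, ∀ T : ℕ, ∫⁻ t in Set.Icc (-T : ℝ) T, h (x + t • v) < ⊤ := by
  rw [ae_all_iff]
  intro T
  have hk : ∀ k : ℕ, ∀ᵐ x : E, x ∈ Metric.ball (0 : E) k →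
      ∫⁻ t in Set.Icc (-T : ℝ) T, hm.mk h (x + t • v) < ⊤ := by
    intro k
    rw [← ae_restrict_iff' measurableSet_ball]
    have hmm : Measurable fun z : E × ℝ => hm.mk h (z.1 + z.2 • v) :=
      hm.measurable_mk.comp (by fun_prop)
    refine ae_lt_top (Measurable.lintegral_prod_right hmm) (ne_of_lt ?_)
    set R : ℝ := k + T * ‖v‖
    rw [lintegral_lintegral_swap hmm.aemeasurable]
    calc ∫⁻ t in Set.Icc (-T : ℝ) T, ∫⁻ x in Metric.ball (0 : E) k, hm.mk h (x + t • v)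
        ≤ ∫⁻ t in Set.Icc (-T : ℝ) T, ∫⁻ x in Metric.ball (0 : E) R, hm.mk h x := by
          refine setLIntegral_mono measurable_const fun t ht => ?_
          rw [← lintegral_indicator measurableSet_ball, ← lintegral_indicator measurableSet_ball,
            ← lintegral_add_right_eq_self ((Metric.ball 0 R).indicator (hm.mk h)) (t • v)]
          refine lintegral_mono fun x => ?_
          by_cases hx : x ∈ Metric.ball (0 : E) k
          · rw [Set.indicator_of_mem hx, Set.indicator_of_mem]
            rw [mem_ball_zero_iff] at hx ⊢
            calc ‖x + t • v‖ ≤ ‖x‖ + |t| * ‖v‖ := by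
                  simpa [norm_smul] using norm_add_le x (t • v)
              _ < k + T * ‖v‖ := by
                  have : |t| * ‖v‖ ≤ T * ‖v‖ := by
                    gcongr
                    exact abs_le.2 ht
                  linarith
          · rw [Set.indicator_of_notMem hx]; exact zero_le
      _ < ⊤ := by
          rw [setLIntegral_const]
          refine ENNReal.mul_lt_top ?_ (by simp)
          rw [lintegral_congr_ae (ae_restrict_of_ae hm.ae_eq_mk.symm)]
          exact hfin R
  filter_upwards [ae_all_iff.2 hk, ae_ae_line hm.ae_eq_mk v] with x hx hx2
  obtain ⟨k, hk⟩ := exists_nat_gt ‖x‖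
  rw [lintegral_congr_ae (ae_restrict_of_ae hx2)]
  exact hx k (by simpa using hk)

/-- Lebesgue's differentiation theorem for open balls; Mathlib states it for closed ones, and spheres
are null sets. -/
theorem ae_tendsto_average_ball {U : E → ℝ} (hU : LocallyIntegrable U volume) :
    ∀ᵐ x : E, Tendsto (fun r => ⨍ y in Metric.ball x r, U y) (𝓝[>] 0) (𝓝 (U x)) := by
  filter_upwards [IsUnifLocDoublingMeasure.ae_tendsto_average volume hU 1] with x hx
  have := hx (l := 𝓝[>] (0 : ℝ)) (fun _ => x) id tendsto_id (by
    filter_upwards [self_mem_nhdsWithin] with r hr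
    simpa using (le_of_lt hr : (0 : ℝ) ≤ r))
  refine this.congr' ?_
  filter_upwards [self_mem_nhdsWithin] with r hr
  refine setAverage_congr ?_
  symm
  rw [ae_eq_set]
  refine ⟨?_, ?_⟩
  · simp [Set.sdiff_eq_empty.2 Metric.ball_subset_closedBall]
  · rw [id_eq, Metric.closedBall_sdiff_ball]
    exact Measure.addHaar_sphere_of_ne_zero volume x (ne_of_gt hr)

theorem setLIntegral_enorm_le_rpow {α : Type*} [MeasurableSpace α] {ν : Measure α} {g : α → ℝ}
    {S s : Set α} (hg : AEMeasurable g (ν.restrict S)) (hs : s ⊆ S) {q : ℝ} (hq : 1 < q) :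
    ∫⁻ y in s, ‖g y‖ₑ ∂ν ≤ (∫⁻ y in S, ‖g y‖ₑ ^ q ∂ν) ^ (1 / q) * ν s ^ (1 - 1 / q) := by
  have hpq : q.HolderConjugate (q / (q - 1)) := Real.HolderConjugate.conjExponent hq
  have H := ENNReal.lintegral_mul_le_Lp_mul_Lq (ν.restrict s) hpq
    (hg.mono_measure (Measure.restrict_mono_set ν hs)).enorm
    (aemeasurable_const (b := (1 : ℝ≥0∞)))
  simp only [Pi.mul_apply, mul_one, ENNReal.one_rpow, lintegral_const,
    Measure.restrict_apply MeasurableSet.univ, Set.univ_inter, one_mul] at H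
  have e : 1 / (q / (q - 1)) = 1 - 1 / q := by
    have : q - 1 ≠ 0 := by linarith
    field_simp
  rw [e] at H
  refine H.trans ?_
  gcongr

end Lines

/-! ### Hölder continuity of limits of averages on almost every line -/

section HolderOnLines

variable {E : Type*} [NormedAddCommGroup E] [InnerProductSpace ℝ E] [FiniteDimensional ℝ E]
  [MeasurableSpace E] [BorelSpace E]

theorem norm_setAverage_ball_le {G : E → ℝ} {M : ℝ≥0∞} (hM : M ≠ ⊤) {x : E} {r : ℝ} (hr : 0 < r)
    (h : ∫⁻ y in Metric.ball x r, ‖G y‖ₑ ≤ M * volume (Metric.ball x r)) :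
    ‖⨍ y in Metric.ball x r, G y‖ ≤ M.toReal := by
  have hv0 : volume (Metric.ball x r) ≠ 0 := (Metric.measure_ball_pos volume x hr).ne'
  have hv : volume (Metric.ball x r) ≠ ⊤ := measure_ball_lt_top.ne
  have hpos : 0 < volume.real (Metric.ball x r) := ENNReal.toReal_pos hv0 hv
  rw [setAverage_eq, norm_smul, norm_inv, Real.norm_of_nonneg hpos.le,
    inv_mul_le_iff₀ hpos]
  have h1 : ‖∫ y in Metric.ball x r, G y‖ₑ ≤ M * volume (Metric.ball x r) :=
    (enorm_integral_le_lintegral_enorm _).trans h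
  have h2 := ENNReal.toReal_mono (ENNReal.mul_ne_top hM hv) h1
  rw [toReal_enorm, ENNReal.toReal_mul] at h2
  rw [mul_comm]
  exact h2

theorem IsWeakDirDeriv.average_ball_sub {Ω : Set E} {v : E} {U G : E → ℝ}
    (hw : IsWeakDirDeriv Ω v U G) (hU : LocallyIntegrable U volume)
    (hG : LocallyIntegrable G volume) {r : ℝ} (hr : 0 < r) {x : E} {s t : ℝ}
    (hx : ∀ τ ∈ Set.uIcc s t, Metric.closedBall (x + τ • v) r ⊆ Ω) :
    (⨍ z in Metric.ball (x + t • v) r, U z) - ⨍ z in Metric.ball (x + s • v) r, U z =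
      ∫ τ in s..t, ⨍ z in Metric.ball (x + τ • v) r, G z := by
  have hc : ∀ y : E, volume.real (Metric.ball y r) = volume.real (Metric.ball (0 : E) r) := by
    intro y
    rw [measureReal_def, measureReal_def, Measure.addHaar_ball_center]
  simp only [setAverage_eq, hc, smul_eq_mul, intervalIntegral.integral_const_mul]
  rw [← hw.integral_ball_sub hU hG hr hx, mul_sub]

/-- On almost every line parallel to `v` the averages of `U` over small balls converge at every point
of every segment contained in `Ω`, and the limit is Hölder continuous with exponent `1 - 1 / q`. -/
theorem IsWeakDirDeriv.ae_exists_holder_limit {Ω : Set E} (hΩ : IsOpen Ω) {v : E} {U G : E → ℝ}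
    (hw : IsWeakDirDeriv Ω v U G) (hU : LocallyIntegrable U volume)
    (hG : LocallyIntegrable G volume) {q : ℝ} (hq : 1 < q) (hGq : ∫⁻ y, ‖G y‖ₑ ^ q ≠ ⊤) :
    ∀ᵐ x : E, ∀ α β : ℝ, α < β → (∀ τ ∈ Set.Icc α β, x + τ • v ∈ Ω) →
      ∃ (w : ℝ → ℝ) (C : ℝ), (∀ τ ∈ Set.Icc α β,
        Tendsto (fun r => ⨍ y in Metric.ball (x + τ • v) r, U y) (𝓝[>] 0) (𝓝 (w τ))) ∧
        ∀ τ ∈ Set.Icc α β, ∀ τ' ∈ Set.Icc α β, |w τ - w τ'| ≤ C * |τ - τ'| ^ (1 - 1 / q) := by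
  have hGe : AEMeasurable (fun y => ‖G y‖ₑ) volume := hG.aestronglyMeasurable.aemeasurable.enorm
  obtain ⟨M, hMm, hM, hMint⟩ := exists_measurable_average_le volume hGe hq hGq
  filter_upwards [ae_ae_line (ae_tendsto_average_ball hU) v,
    ae_ae_line (ae_tendsto_average_ball hG) v,
    ae_lintegral_line_lt_top hMm.aemeasurable (fun R => hMint _ measure_ball_lt_top.ne) v,
    ae_lintegral_line_lt_top (hGe.pow_const q)
      (fun R => (setLIntegral_le_lintegral _ _).trans_lt hGq.lt_top) v] with x hxU hxG hxM hxq
  intro α β hαβ hseg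
  obtain ⟨T, hT⟩ := exists_nat_gt (max |α| |β|)
  have hIT : Set.Icc α β ⊆ Set.Icc (-T : ℝ) T := by
    have h1 := (abs_lt.1 ((le_max_left _ _).trans_lt hT)).1
    have h2 := (abs_lt.1 ((le_max_right _ _).trans_lt hT)).2
    exact Set.Icc_subset_Icc h1.le h2.le
  -- a uniform radius for the balls centred on the segment
  obtain ⟨δ, hδ0, hδ⟩ : ∃ δ > 0, ∀ r ∈ Set.Ioo (0 : ℝ) δ, ∀ τ ∈ Set.Icc α β,
      Metric.closedBall (x + τ • v) r ⊆ Ω := by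
    have hK : IsCompact ((fun τ : ℝ => x + τ • v) '' Set.Icc α β) :=
      isCompact_Icc.image (by fun_prop)
    obtain ⟨δ, hδ0, hδ⟩ := hK.exists_cthickening_subset_open hΩ (by
      rintro _ ⟨τ, hτ, rfl⟩; exact hseg τ hτ)
    exact ⟨δ, hδ0, fun r hr τ hτ => ((Metric.closedBall_subset_closedBall hr.2.le).trans
      (Metric.closedBall_subset_cthickening (Set.mem_image_of_mem _ hτ) δ)).trans hδ⟩
  have hsmall : ∀ᶠ r : ℝ in 𝓝[>] 0, 0 < r ∧ r < δ ∧ r < 1 := by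
    filter_upwards [self_mem_nhdsWithin, mem_nhdsWithin_of_mem_nhds (Iio_mem_nhds hδ0),
      mem_nhdsWithin_of_mem_nhds (Iio_mem_nhds one_pos)] with r h1 h2 h3 using ⟨h1, h2, h3⟩
  have hav : ∀ r : ℝ, AEStronglyMeasurable
      (fun τ : ℝ => ⨍ y in Metric.ball (x + τ • v) r, G y) volume := by
    intro r
    have hc : ∀ y : E, volume.real (Metric.ball y r) = volume.real (Metric.ball (0 : E) r) := by
      intro y
      rw [measureReal_def, measureReal_def, Measure.addHaar_ball_center]
    simp only [setAverage_eq, hc, smul_eq_mul]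
    exact (((stronglyMeasurable_integral_ball hG r).comp_measurable
      (by fun_prop : Measurable fun τ : ℝ => x + τ • v)).const_mul _).aestronglyMeasurable
  -- measurability of `G` along the line comes for free from the convergence of the averages
  have hGl : AEStronglyMeasurable (fun τ : ℝ => G (x + τ • v)) volume :=
    aestronglyMeasurable_of_tendsto_ae (𝓝[>] (0 : ℝ)) hav hxG
  set I : ℝ≥0∞ := (∫⁻ τ in Set.Icc α β, ‖G (x + τ • v)‖ₑ ^ q) ^ (1 / q) with hI
  have hq0 : 0 < q := by linarith
  have hq1 : 0 ≤ 1 - 1 / q := by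
    rw [sub_nonneg, div_le_one hq0]; exact hq.le
  have hItop : I ≠ ⊤ := ENNReal.rpow_ne_top_of_nonneg (by positivity)
    (lt_of_le_of_lt (lintegral_mono_set hIT) (hxq T)).ne
  have hhol : ∀ s ⊆ Set.Icc α β, ∫⁻ τ in s, ‖G (x + τ • v)‖ₑ ≤ I * volume s ^ (1 - 1 / q) :=
    fun s hs => setLIntegral_enorm_le_rpow hGl.aemeasurable.restrict hs hq
  have hGint : IntegrableOn (fun τ : ℝ => G (x + τ • v)) (Set.Icc α β) := by
    refine ⟨hGl.restrict, (hhol _ subset_rfl).trans_lt ?_⟩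
    exact ENNReal.mul_lt_top hItop.lt_top (ENNReal.rpow_lt_top_of_nonneg hq1 (by simp))
  have hii : ∀ s ∈ Set.Icc α β, ∀ t ∈ Set.Icc α β,
      IntervalIntegrable (fun τ : ℝ => G (x + τ • v)) volume s t := fun s hs t ht =>
    (hGint.mono_set (Set.uIcc_subset_Icc hs ht)).intervalIntegrable
  -- a point of the segment where the averages of `U` converge
  obtain ⟨s, hs, hsU⟩ : ∃ s ∈ Set.Icc α β,
      Tendsto (fun r => ⨍ y in Metric.ball (x + s • v) r, U y) (𝓝[>] 0) (𝓝 (U (x + s • v))) := by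
    by_contra! hcon
    have : volume (Set.Icc α β) = 0 :=
      measure_mono_null (fun s hs => hcon s hs) (ae_iff.1 hxU)
    rw [Real.volume_Icc, ENNReal.ofReal_eq_zero] at this
    linarith
  have hMl : IntegrableOn (fun τ : ℝ => (M (x + τ • v)).toReal) (Set.Icc α β) :=
    (integrable_toReal_of_lintegral_ne_top
      (hMm.comp (by fun_prop : Measurable fun τ : ℝ => x + τ • v)).aemeasurable
      (lt_of_le_of_lt (lintegral_mono_set hIT) (hxM T)).ne)
  have hMfin : ∀ᵐ τ : ℝ, τ ∈ Set.Icc α β → M (x + τ • v) < ⊤ := by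
    rw [← ae_restrict_iff' measurableSet_Icc]
    exact ae_lt_top (hMm.comp (by fun_prop : Measurable fun τ : ℝ => x + τ • v))
      (lt_of_le_of_lt (lintegral_mono_set hIT) (hxM T)).ne
  refine ⟨fun τ => U (x + s • v) + ∫ σ in s..τ, G (x + σ • v), I.toReal, ?_, ?_⟩
  · intro τ hτ
    have hsub : Set.uIcc s τ ⊆ Set.Icc α β := Set.uIcc_subset_Icc hs hτ
    have hlim : Tendsto (fun r : ℝ => ∫ σ in s..τ, ⨍ y in Metric.ball (x + σ • v) r, G y)
        (𝓝[>] 0) (𝓝 (∫ σ in s..τ, G (x + σ • v))) := by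
      refine intervalIntegral.tendsto_integral_filter_of_dominated_convergence
        (fun σ => (M (x + σ • v)).toReal) (Eventually.of_forall fun r => (hav r).restrict) ?_
        (hMl.mono_set hsub).intervalIntegrable (hxG.mono fun σ hσ _ => hσ)
      filter_upwards [hsmall] with r hr
      filter_upwards [hMfin] with σ hσ hσI
      exact norm_setAverage_ball_le (hσ (hsub (Set.uIoc_subset_uIcc hσI))).ne hr.1
        (hM _ r ⟨hr.1, hr.2.2⟩)
    refine (hsU.add hlim).congr' ?_
    filter_upwards [hsmall] with r hr
    rw [← hw.average_ball_sub hU hG hr.1 (fun σ hσ => hδ r ⟨hr.1, hr.2.1⟩ σ (hsub hσ))]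
    ring
  · intro τ hτ τ' hτ'
    rw [add_sub_add_left_eq_sub,
      intervalIntegral.integral_interval_sub_left (hii s hs τ hτ) (hii s hs τ' hτ'),
      ← Real.norm_eq_abs, intervalIntegral.norm_intervalIntegral_eq]
    have h1 := (enorm_integral_le_lintegral_enorm (μ := volume.restrict (Set.uIoc τ' τ))
      (fun σ : ℝ => G (x + σ • v))).trans
      (hhol _ (Set.uIoc_subset_uIcc.trans (Set.uIcc_subset_Icc hτ' hτ)))
    have h2 := ENNReal.toReal_mono (ENNReal.mul_ne_top hItop
      (ENNReal.rpow_ne_top_of_nonneg hq1 (by simp))) h1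
    rw [toReal_enorm, ENNReal.toReal_mul, Real.volume_uIoc, ← ENNReal.toReal_rpow (ENNReal.ofReal _),
      ENNReal.toReal_ofReal (abs_nonneg _)] at h2
    exact h2

end HolderOnLines

/-! ### Determinants of Hölder functions and the divergence of negative powers -/

section HolderDeterminant

/-- If `|h| ≤ C |t - t₀| ^ θ` near `t₀` and `θ a ≥ 1`, then `|h| ^ (-a)` dominates a multiple of
`|t - t₀|⁻¹` and is not integrable. The value of the integrand is `∞` where `h = 0`. -/
theorem lintegral_rpow_neg_eq_top_of_holder_zero {h : ℝ → ℝ} {θ a C α β t₀ : ℝ}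
    (ha : 0 ≤ a) (hθa : 1 ≤ θ * a) (hαβ : α < β) (ht₀ : t₀ ∈ Set.Icc α β)
    (hh : ∀ t ∈ Set.Icc α β, |h t| ≤ C * |t - t₀| ^ θ) :
    ∫⁻ t in Set.Icc α β, ENNReal.ofReal |h t| ^ (-a) = ⊤ := by
  by_contra hfin
  set C' := |C| + 1
  have hC' : 0 < C' := by positivity
  have hL : 0 < β - α := sub_pos.2 hαβ
  -- `|h| ^ a ≤ C' ^ a |t - t₀| ^ (θ a) ≤ K |t - t₀|`, as `θ a - 1 ≥ 0` and `|t - t₀| ≤ β - α`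
  set K := C' ^ a * (β - α) ^ (θ * a - 1)
  have hK : 0 < K := by positivity
  have key : ∀ t ∈ Set.Icc α β,
      ‖(t - t₀)⁻¹‖ₑ ≤ ENNReal.ofReal K * ENNReal.ofReal |h t| ^ (-a) := by
    intro t ht
    rcases eq_or_ne t t₀ with rfl | hne
    · simp
    have hpos : 0 < |t - t₀| := abs_pos.2 (sub_ne_zero.2 hne)
    have hle : |t - t₀| ≤ β - α := by
      rw [abs_le]; constructor <;> linarith [ht.1, ht.2, ht₀.1, ht₀.2]
    have ha0 : 0 < a := lt_of_le_of_ne ha fun h0 => by rw [← h0] at hθa; norm_num at hθa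
    by_cases h0 : h t = 0
    · rw [h0, abs_zero, ENNReal.ofReal_zero, ENNReal.zero_rpow_of_neg (by linarith),
        ENNReal.mul_top (by simpa using hK)]
      exact le_top
    have hhp : 0 < |h t| := abs_pos.2 h0
    rw [ENNReal.ofReal_rpow_of_pos hhp, ← ENNReal.ofReal_mul hK.le, ← ofReal_norm]
    refine ENNReal.ofReal_le_ofReal ?_
    rw [Real.norm_eq_abs, abs_inv, Real.rpow_neg hhp.le, ← div_eq_mul_inv,
      inv_le_comm₀ hpos (by positivity), inv_div, div_le_iff₀ hK]
    calc |h t| ^ a ≤ (C' * |t - t₀| ^ θ) ^ a := by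
          refine Real.rpow_le_rpow hhp.le ((hh t ht).trans ?_) ha
          gcongr
          linarith [le_abs_self C]
      _ = C' ^ a * |t - t₀| ^ (θ * a - 1) * |t - t₀| := by
          rw [Real.mul_rpow hC'.le (by positivity), ← Real.rpow_mul hpos.le, mul_assoc]
          congr 1
          rw [← Real.rpow_add_one hpos.ne', sub_add_cancel]
      _ ≤ |t - t₀| * K := by
          rw [mul_comm]
          refine mul_le_mul_of_nonneg_left (mul_le_mul_of_nonneg_left
            (Real.rpow_le_rpow hpos.le hle (by linarith)) (by positivity)) hpos.le
  have hint : IntegrableOn (fun t : ℝ => (t - t₀)⁻¹) (Set.Icc α β) := by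
    refine ⟨(by fun_prop : Measurable fun t : ℝ => (t - t₀)⁻¹).aestronglyMeasurable, ?_⟩
    refine (setLIntegral_mono' measurableSet_Icc key).trans_lt ?_
    rw [lintegral_const_mul' _ _ ENNReal.ofReal_ne_top]
    exact ENNReal.mul_lt_top ENNReal.ofReal_lt_top (lt_top_iff_ne_top.2 hfin)
  rw [← Set.uIcc_of_le hαβ.le] at hint
  rcases intervalIntegrable_sub_inv_iff.1 hint.intervalIntegrable with h1 | h1
  · exact hαβ.ne h1
  · exact h1 (by rwa [Set.uIcc_of_le hαβ.le])

theorem continuousOn_of_holder {h : ℝ → ℝ} {θ C : ℝ} (hθ : 0 < θ) {s : Set ℝ}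
    (hh : ∀ t ∈ s, ∀ t' ∈ s, |h t - h t'| ≤ C * |t - t'| ^ θ) : ContinuousOn h s := by
  intro t₀ ht₀
  rw [ContinuousWithinAt, tendsto_iff_dist_tendsto_zero]
  have h1 : Tendsto (fun t : ℝ => C * |t - t₀| ^ θ) (𝓝[s] t₀) (𝓝 0) := by
    have : Continuous fun t : ℝ => C * |t - t₀| ^ θ :=
      continuous_const.mul ((by fun_prop : Continuous fun t : ℝ => |t - t₀|).rpow_const
        fun _ => Or.inr hθ.le)
    have h2 := this.tendsto t₀
    simp only [sub_self, abs_zero, Real.zero_rpow hθ.ne', mul_zero] at h2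
    exact h2.mono_left nhdsWithin_le_nhds
  refine squeeze_zero' (Eventually.of_forall fun _ => dist_nonneg) ?_ h1
  filter_upwards [self_mem_nhdsWithin] with t ht
  exact hh t ht t₀ ht₀

theorem contDiff_det (n : ℕ) :
    ContDiff ℝ 1 fun m : Fin n → Fin n → ℝ => (Matrix.of m).det := by
  simp only [Matrix.det_apply', Matrix.of_apply]
  refine ContDiff.sum fun σ _ => contDiff_const.mul (contDiff_prod fun i _ => ?_)
  fun_prop

/-- The determinant of a matrix of Hölder functions is Hölder continuous with the same exponent,
because the determinant is Lipschitz on bounded sets. -/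
theorem exists_holder_det {n : ℕ} {A : ℝ → Fin n → Fin n → ℝ} {θ α β : ℝ} (hθ : 0 ≤ θ)
    {C : Fin n → Fin n → ℝ}
    (hA : ∀ i j, ∀ t ∈ Set.Icc α β, ∀ t' ∈ Set.Icc α β,
      |A t i j - A t' i j| ≤ C i j * |t - t'| ^ θ) :
    ∃ K : ℝ, ∀ t ∈ Set.Icc α β, ∀ t' ∈ Set.Icc α β,
      |(Matrix.of (A t)).det - (Matrix.of (A t')).det| ≤ K * |t - t'| ^ θ := by
  set S := ∑ i, ∑ j, |C i j| with hS
  have hCS : ∀ i j, C i j ≤ S := fun i j => (le_abs_self _).trans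
    ((Finset.single_le_sum (f := fun j => |C i j|) (fun _ _ => abs_nonneg _)
      (Finset.mem_univ j)).trans
    (Finset.single_le_sum (f := fun i => ∑ j, |C i j|)
      (fun _ _ => Finset.sum_nonneg fun _ _ => abs_nonneg _) (Finset.mem_univ i)))
  have hS0 : 0 ≤ S := Finset.sum_nonneg fun _ _ => Finset.sum_nonneg fun _ _ => abs_nonneg _
  have hnorm : ∀ t ∈ Set.Icc α β, ∀ t' ∈ Set.Icc α β, ‖A t - A t'‖ ≤ S * |t - t'| ^ θ := by
    intro t ht t' ht'
    refine (pi_norm_le_iff_of_nonneg (by positivity)).2 fun i =>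
      (pi_norm_le_iff_of_nonneg (by positivity)).2 fun j => ?_
    refine (hA i j t ht t' ht').trans ?_
    gcongr
    exact hCS i j
  rcases lt_or_ge β α with hlt | hle
  · exact ⟨0, fun t ht => absurd (ht.1.trans ht.2) (not_le.2 hlt)⟩
  set R := S * (β - α) ^ θ
  obtain ⟨K, hK⟩ := (contDiff_det n).contDiffOn.exists_lipschitzOnWith one_ne_zero
    (convex_closedBall (A α) R) (isCompact_closedBall (A α) R)
  have hmem : ∀ t ∈ Set.Icc α β, A t ∈ Metric.closedBall (A α) R := by
    intro t ht
    rw [Metric.mem_closedBall, dist_eq_norm]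
    refine (hnorm t ht α ⟨le_rfl, hle⟩).trans ?_
    have : |t - α| ≤ β - α := by rw [abs_of_nonneg] <;> linarith [ht.1, ht.2]
    exact mul_le_mul_of_nonneg_left (Real.rpow_le_rpow (abs_nonneg _) this hθ) hS0
  refine ⟨K * S, fun t ht t' ht' => ?_⟩
  have := hK.dist_le_mul _ (hmem t ht) _ (hmem t' ht')
  rw [Real.dist_eq, dist_eq_norm] at this
  refine this.trans ?_
  rw [mul_assoc]
  gcongr
  exact hnorm t ht t' ht'

end HolderDeterminant

/-! ### Sobolev functions and their precise representatives -/

section Sobolev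

variable {n : ℕ} {Ω : Set (EuclideanSpace ℝ (Fin n))}

theorem MeasureTheory.LocallyIntegrableOn.integrableOn_mul_of_tsupport_subset
    {g φ : EuclideanSpace ℝ (Fin n) → ℝ} (hg : LocallyIntegrableOn g Ω volume)
    (hφ : Continuous φ) (hc : HasCompactSupport φ) (hs : tsupport φ ⊆ Ω) :
    IntegrableOn (fun x => g x * φ x) Ω := by
  have h1 : IntegrableOn (fun x => g x * φ x) (tsupport φ) :=
    (hg.integrableOn_compact_subset hs hc).mul_continuousOn hφ.continuousOn hc
  refine IntegrableOn.mono_set (t := Set.univ) ?_ (Set.subset_univ _)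
  rw [integrableOn_univ]
  refine (integrableOn_iff_integrable_of_support_subset fun x hx => ?_).1 h1
  exact subset_tsupport _ (right_ne_zero_of_mul hx)

theorem IsWeakPartialDeriv.ae_eq (hΩ : IsOpen Ω) {i : Fin n}
    {u g g' : EuclideanSpace ℝ (Fin n) → ℝ} (h : IsWeakPartialDeriv Ω i u g)
    (h' : IsWeakPartialDeriv Ω i u g') : ∀ᵐ x, x ∈ Ω → g x = g' x := by
  have hsub : ∀ᵐ x, x ∈ Ω → (fun x => g x - g' x) x = 0 := by
    refine hΩ.ae_eq_zero_of_integral_contDiff_smul_eq_zero (h.2.1.sub h'.2.1)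
      fun φ hφ hc hs => ?_
    rw [← setIntegral_eq_integral_of_forall_compl_eq_zero (s := Ω) (fun x hx => by
      rw [image_eq_zero_of_notMem_tsupport (fun hx' => hx (hs hx')), zero_smul])]
    have e1 := h.2.2 φ hφ hc hs
    have e2 := h'.2.2 φ hφ hc hs
    have e3 : ∫ x in Ω, g x * φ x = ∫ x in Ω, g' x * φ x := by linarith
    calc ∫ x in Ω, φ x • (g x - g' x) = ∫ x in Ω, (g x * φ x - g' x * φ x) := by
          congr 1; ext x; rw [smul_eq_mul]; ring
      _ = 0 := by
          rw [integral_sub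
            (h.2.1.integrableOn_mul_of_tsupport_subset hφ.continuous hc hs)
            (h'.2.1.integrableOn_mul_of_tsupport_subset hφ.continuous hc hs), e3, sub_self]
  filter_upwards [hsub] with x hx hxΩ
  exact sub_eq_zero.1 (hx hxΩ)

theorem MeasureTheory.MemLp.locallyIntegrable_indicator (hΩ : IsOpen Ω)
    {u : EuclideanSpace ℝ (Fin n) → ℝ} {p : ℝ≥0∞} (hp : 1 ≤ p)
    (hu : MemLp u p (volume.restrict Ω)) : LocallyIntegrable (Ω.indicator u) volume :=
  ((memLp_indicator_iff_restrict hΩ.measurableSet).2 hu).locallyIntegrable hp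

theorem IsWeakPartialDeriv.isWeakDirDeriv_single (hΩ : IsOpen Ω) {k : Fin n}
    {u g : EuclideanSpace ℝ (Fin n) → ℝ} (h : IsWeakPartialDeriv Ω k u g) :
    IsWeakDirDeriv Ω (EuclideanSpace.single k 1) (Ω.indicator u) (Ω.indicator g) := by
  intro φ hφ hc hs
  have := h.2.2 φ hφ hc hs
  rw [← integral_indicator hΩ.measurableSet, ← integral_indicator hΩ.measurableSet] at this
  simpa only [Set.indicator_mul_left] using this

theorem isWeakDirDeriv_sum {U : EuclideanSpace ℝ (Fin n) → ℝ}
    {G : Fin n → EuclideanSpace ℝ (Fin n) → ℝ} (hU : LocallyIntegrable U volume)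
    (hG : ∀ k, LocallyIntegrable (G k) volume)
    (h : ∀ k, IsWeakDirDeriv Ω (EuclideanSpace.single k 1) U (G k))
    (v : EuclideanSpace ℝ (Fin n)) :
    IsWeakDirDeriv Ω v U (fun x => ∑ k, v k * G k x) := by
  intro φ hφ hc hs
  have hv : v = ∑ k, v k • EuclideanSpace.single k (1 : ℝ) := by
    ext j; simp [Finset.sum_apply, Pi.single_apply]
  have hint : ∀ k, Integrable fun z => U z * fderiv ℝ φ z (EuclideanSpace.single k 1) := by
    intro k
    have hcont : Continuous fun z => fderiv ℝ φ z (EuclideanSpace.single k 1) :=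
      (hφ.continuous_fderiv (by simp)).clm_apply continuous_const
    have := hU.integrable_smul_left_of_hasCompactSupport hcont (hc.fderiv_apply ℝ _)
    simpa [mul_comm] using this
  have hint' : ∀ k, Integrable fun z => G k z * φ z := by
    intro k
    have := (hG k).integrable_smul_left_of_hasCompactSupport hφ.continuous hc
    simpa [mul_comm] using this
  calc ∫ z, U z * fderiv ℝ φ z v
      = ∫ z, ∑ k, v k * (U z * fderiv ℝ φ z (EuclideanSpace.single k 1)) := by
        congr 1; ext z
        conv_lhs => rw [hv, map_sum, Finset.mul_sum]
        refine Finset.sum_congr rfl fun k _ => ?_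
        rw [map_smul, smul_eq_mul]; ring
    _ = ∑ k, v k * -∫ z, G k z * φ z := by
        rw [integral_finsetSum _ fun k _ => (hint k).const_mul _]
        refine Finset.sum_congr rfl fun k _ => ?_
        rw [integral_const_mul, h k φ hφ hc hs]
    _ = -∫ z, (∑ k, v k * G k z) * φ z := by
        simp only [Finset.sum_mul, mul_assoc]
        rw [integral_finsetSum _ fun k _ => (hint' k).const_mul _, ← Finset.sum_neg_distrib]
        refine Finset.sum_congr rfl fun k _ => ?_
        rw [integral_const_mul, mul_neg]

theorem preciseRep_eq_of_tendsto {g : EuclideanSpace ℝ (Fin n) → ℝ}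
    {x : EuclideanSpace ℝ (Fin n)} {w : ℝ}
    (h : Tendsto (fun r => ⨍ y in Metric.ball x r, g y) (𝓝[>] 0) (𝓝 w)) :
    preciseRep g x = w := by
  have h1 : Tendsto (fun r => ((⨍ y in Metric.ball x r, g y : ℝ) : EReal)) (𝓝[>] 0) (𝓝 w) :=
    (continuous_coe_real_ereal.tendsto w).comp h
  rw [preciseRep, h1.limsup_eq, EReal.toReal_coe]

/-- The precise representative at a point of `Ω` depends only on the values in `Ω` up to null sets:
small balls about the point lie in `Ω`. -/
theorem preciseRep_eq_of_tendsto_indicator (hΩ : IsOpen Ω)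
    {d u : EuclideanSpace ℝ (Fin n) → ℝ} (hdu : ∀ᵐ x, x ∈ Ω → d x = u x)
    {x : EuclideanSpace ℝ (Fin n)} (hx : x ∈ Ω) {w : ℝ}
    (h : Tendsto (fun r => ⨍ y in Metric.ball x r, Ω.indicator u y) (𝓝[>] 0) (𝓝 w)) :
    preciseRep d x = w := by
  refine preciseRep_eq_of_tendsto (h.congr' ?_)
  obtain ⟨ε, hε, hball⟩ := Metric.isOpen_iff.1 hΩ x hx
  filter_upwards [mem_nhdsWithin_of_mem_nhds (Iio_mem_nhds hε)] with r hr
  refine setAverage_congr_fun measurableSet_ball ?_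
  filter_upwards [hdu] with y hy hyb
  have hyΩ : y ∈ Ω := hball (Metric.ball_subset_ball (le_of_lt hr) hyb)
  rw [Set.indicator_of_mem hyΩ, hy hyΩ]

theorem ae_preciseRep_eq (hΩ : IsOpen Ω) {p : ℝ≥0∞} (hp : 1 ≤ p)
    {d u : EuclideanSpace ℝ (Fin n) → ℝ} (hdu : ∀ᵐ x, x ∈ Ω → d x = u x)
    (hu : MemLp u p (volume.restrict Ω)) : ∀ᵐ x, x ∈ Ω → preciseRep d x = u x := by
  filter_upwards [ae_tendsto_average_ball (hu.locallyIntegrable_indicator hΩ hp)] with x hx hxΩ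
  rw [Set.indicator_of_mem hxΩ] at hx
  exact preciseRep_eq_of_tendsto_indicator hΩ hdu hxΩ hx

/-- The precise representative of a function in `W^{1,q}(Ω)` is Hölder continuous with exponent
`1 - 1 / q` on the segments in `Ω` of almost every line parallel to `v`. -/
theorem MemSobolevW.ae_exists_holder_preciseRep (hΩ : IsOpen Ω) {q : ℝ} (hq : 1 < q)
    {d u : EuclideanSpace ℝ (Fin n) → ℝ} (hu : MemSobolevW Ω (ENNReal.ofReal q) 1 u)
    (hdu : ∀ᵐ x, x ∈ Ω → d x = u x) (v : EuclideanSpace ℝ (Fin n)) :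
    ∀ᵐ x, ∀ α β : ℝ, α < β → (∀ τ ∈ Set.Icc α β, x + τ • v ∈ Ω) →
      ∃ C : ℝ, ∀ τ ∈ Set.Icc α β, ∀ τ' ∈ Set.Icc α β,
        |preciseRep d (x + τ • v) - preciseRep d (x + τ' • v)| ≤ C * |τ - τ'| ^ (1 - 1 / q) := by
  obtain ⟨hu0, hu1⟩ := hu
  choose g hg hgL using hu1
  have hp : 1 ≤ ENNReal.ofReal q := by
    rw [← ENNReal.ofReal_one]; exact ENNReal.ofReal_le_ofReal hq.le
  have hgL' : ∀ k, MemLp (g k) (ENNReal.ofReal q) (volume.restrict Ω) := hgL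
  have hGL : ∀ k, MemLp (Ω.indicator (g k)) (ENNReal.ofReal q) volume := fun k =>
    (memLp_indicator_iff_restrict hΩ.measurableSet).2 (hgL' k)
  have hU := hu0.locallyIntegrable_indicator hΩ hp
  have hG : MemLp (fun x => ∑ k, v k * Ω.indicator (g k) x) (ENNReal.ofReal q) volume :=
    memLp_finsetSum _ fun k _ => (hGL k).const_mul _
  have hw := isWeakDirDeriv_sum hU (fun k => (hGL k).locallyIntegrable hp)
    (fun k => (hg k).isWeakDirDeriv_single hΩ) v
  have hGq := lintegral_rpow_enorm_lt_top_of_eLpNorm_lt_top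
    (by simpa using (by linarith : 0 < q)) ENNReal.ofReal_ne_top hG.2
  rw [ENNReal.toReal_ofReal (by linarith)] at hGq
  filter_upwards [hw.ae_exists_holder_limit hΩ hU (hG.locallyIntegrable hp) hq hGq.ne]
    with x hx α β hαβ hseg
  obtain ⟨w, C, hlim, hC⟩ := hx α β hαβ hseg
  refine ⟨C, fun τ hτ τ' hτ' => ?_⟩
  rw [preciseRep_eq_of_tendsto_indicator hΩ hdu (hseg τ hτ) (hlim τ hτ),
    preciseRep_eq_of_tendsto_indicator hΩ hdu (hseg τ' hτ') (hlim τ' hτ')]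
  exact hC τ hτ τ' hτ'

end Sobolev

/-! ### The Jacobian on almost every line -/

section Jacobian

variable {n : ℕ} {Ω : Set (EuclideanSpace ℝ (Fin n))}

/-- On almost every line parallel to `v` the Jacobian is continuous and has no zero along segments
contained in `Ω`. -/
theorem ae_line_continuousOn_preciseJacobian_ne_zero {q a : ℝ} (hq : 1 < q)
    (hqa : 1 ≤ (1 - 1 / q) * a) (hΩ : IsOpen Ω)
    {D : EuclideanSpace ℝ (Fin n) → Matrix (Fin n) (Fin n) ℝ}
    {u : Fin n → Fin n → EuclideanSpace ℝ (Fin n) → ℝ}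
    (hu : ∀ i j, MemSobolevW Ω (ENNReal.ofReal q) 1 (u i j))
    (hDu : ∀ i j, ∀ᵐ x, x ∈ Ω → D x i j = u i j x)
    (hJm : AEMeasurable (preciseJacobian D) (volume.restrict Ω))
    (hJ : ∫⁻ x in Ω, (ENNReal.ofReal |preciseJacobian D x|) ^ (-a) < ⊤)
    (v : EuclideanSpace ℝ (Fin n)) :
    ∀ᵐ x, ∀ α β : ℝ, α < β → (∀ τ ∈ Set.Icc α β, x + τ • v ∈ Ω) →
      ContinuousOn (fun τ => preciseJacobian D (x + τ • v)) (Set.Icc α β) ∧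
        ∀ τ ∈ Set.Icc α β, preciseJacobian D (x + τ • v) ≠ 0 := by
  have hθ : 0 < 1 - 1 / q := by
    rw [sub_pos, div_lt_one (by linarith)]; exact hq
  have ha : 0 ≤ a := by
    by_contra! hneg
    nlinarith
  have hm : AEMeasurable (Ω.indicator fun x => ENNReal.ofReal |preciseJacobian D x| ^ (-a))
      volume := by
    rw [aemeasurable_indicator_iff hΩ.measurableSet]
    exact (hJm.abs.ennreal_ofReal).pow_const _
  have hfin : ∀ R : ℝ, ∫⁻ x in Metric.ball 0 R,
      Ω.indicator (fun x => ENNReal.ofReal |preciseJacobian D x| ^ (-a)) x < ⊤ := fun R =>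
    (setLIntegral_le_lintegral _ _).trans_lt (by rwa [lintegral_indicator hΩ.measurableSet])
  have hH : ∀ᵐ x, ∀ i j, ∀ α β : ℝ, α < β → (∀ τ ∈ Set.Icc α β, x + τ • v ∈ Ω) →
      ∃ C : ℝ, ∀ τ ∈ Set.Icc α β, ∀ τ' ∈ Set.Icc α β,
        |preciseRep (fun y => D y i j) (x + τ • v) - preciseRep (fun y => D y i j) (x + τ' • v)|
          ≤ C * |τ - τ'| ^ (1 - 1 / q) :=
    ae_all_iff.2 fun i => ae_all_iff.2 fun j =>
      (hu i j).ae_exists_holder_preciseRep hΩ hq (hDu i j) v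
  filter_upwards [hH, ae_lintegral_line_lt_top hm hfin v] with x hx hxJ α β hαβ hseg
  choose C hC using fun i j => hx i j α β hαβ hseg
  obtain ⟨K, hK⟩ := exists_holder_det (A := fun τ i j =>
    preciseRep (fun y => D y i j) (x + τ • v)) hθ.le hC
  refine ⟨continuousOn_of_holder hθ hK, fun τ₀ hτ₀ h0 => ?_⟩
  have hzero := lintegral_rpow_neg_eq_top_of_holder_zero
    (h := fun τ => preciseJacobian D (x + τ • v)) ha hqa hαβ hτ₀ (fun t ht => by
      have := hK t ht τ₀ hτ₀
      change |preciseJacobian D (x + t • v) - preciseJacobian D (x + τ₀ • v)| ≤ _ at this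
      rwa [h0, sub_zero] at this)
  obtain ⟨T, hT⟩ := exists_nat_gt (max |α| |β|)
  have hIT : Set.Icc α β ⊆ Set.Icc (-T : ℝ) T := by
    have h1 := (abs_lt.1 ((le_max_left _ _).trans_lt hT)).1
    have h2 := (abs_lt.1 ((le_max_right _ _).trans_lt hT)).2
    exact Set.Icc_subset_Icc h1.le h2.le
  refine (lt_of_le_of_lt ?_ (hxJ T)).ne hzero
  refine le_trans (le_of_eq ?_) (lintegral_mono_set hIT)
  refine setLIntegral_congr_fun measurableSet_Icc fun τ hτ => ?_
  simp only [Set.indicator_of_mem (hseg τ hτ)]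

theorem aemeasurable_preciseJacobian {p : ℝ≥0∞} (hp : 1 ≤ p) (hΩ : IsOpen Ω)
    {D : EuclideanSpace ℝ (Fin n) → Matrix (Fin n) (Fin n) ℝ}
    {u : Fin n → Fin n → EuclideanSpace ℝ (Fin n) → ℝ}
    (hu : ∀ i j, MemLp (u i j) p (volume.restrict Ω))
    (hDu : ∀ i j, ∀ᵐ x, x ∈ Ω → D x i j = u i j x) :
    AEMeasurable (preciseJacobian D) (volume.restrict Ω) := by
  have h1 : AEMeasurable (fun x => (Matrix.of fun i j => u i j x).det) (volume.restrict Ω) := by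
    simp only [Matrix.det_apply', Matrix.of_apply]
    exact Finset.aemeasurable_fun_sum _ fun σ _ => (Finset.aemeasurable_fun_prod _ fun i _ =>
      (hu _ _).1.aemeasurable).const_mul _
  refine h1.congr ?_
  have h2 : ∀ᵐ x, ∀ i j, x ∈ Ω → preciseRep (fun y => D y i j) x = u i j x :=
    ae_all_iff.2 fun i => ae_all_iff.2 fun j => ae_preciseRep_eq hΩ hp (hDu i j) (hu i j)
  filter_upwards [ae_restrict_of_ae h2, ae_restrict_mem hΩ.measurableSet] with x hx hxΩ
  simp only [preciseJacobian, hx _ _ hxΩ]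

end Jacobian

/-! ### Projections of unions of parallel lines -/

section Projection
/-- The projection to a hyperplane of a null set that is a union of normal lines is `ℋ^{n-1}`-null:
the set is the product of its projection with a line. -/
theorem hausdorffMeasure_orthogonalProjection_image_eq_zero {n : ℕ} (hn : 1 ≤ n)
    {Z : Set (EuclideanSpace ℝ (Fin n))} (hZ : volume Z = 0)
    (P : AffineSubspace ℝ (EuclideanSpace ℝ (Fin n))) [Nonempty P]
    (hP : Module.finrank ℝ P.direction = n - 1)
    (hinv : ∀ x ∈ Z, ∀ w ∈ P.directionᗮ, x + w ∈ Z) :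
    Measure.hausdorffMeasure ((n : ℝ) - 1)
      ((fun x => (EuclideanGeometry.orthogonalProjection P x : EuclideanSpace ℝ (Fin n))) '' Z)
      = 0 := by
  obtain ⟨p⟩ := ‹Nonempty P›
  have : Nonempty P := ⟨p⟩
  set s := P.direction
  set e := s.measurableEquivProd (p : EuclideanSpace ℝ (Fin n)) with he
  have hmp : MeasurePreserving e volume volume := by
    have := s.measurePreserving_measurableEquivProd (p : EuclideanSpace ℝ (Fin n))
    rwa [InnerProductSpace.euclideanHausdorffMeasure_eq_volume] at this
  have h1 : volume (e.symm ⁻¹' Z) = 0 := by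
    rw [hmp.symm.measure_preimage_equiv, hZ]
  have h2 : volume (Prod.swap ⁻¹' (e.symm ⁻¹' Z) : Set (sᗮ × s)) = 0 := 
    (Measure.measurePreserving_swap (μ := (volume : Measure sᗮ))
      (ν := (volume : Measure s))).quasiMeasurePreserving.preimage_null h1
  obtain ⟨w, hw⟩ := (Measure.measure_ae_null_of_prod_null h2).exists
  have h3 : volume {y : s | (y : EuclideanSpace ℝ (Fin n)) + p ∈ Z} = 0 := by
    refine measure_mono_null (fun y hy => ?_) hw
    have := hinv _ hy w w.2
    simp only [Set.mem_preimage, Prod.swap_prod_mk, he, Submodule.measurableEquivProd_symm_apply, vadd_eq_add]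
    convert this using 1
    abel
  have h4 : Measure.hausdorffMeasure ((n : ℝ) - 1)
      {y : s | (y : EuclideanSpace ℝ (Fin n)) + p ∈ Z} = 0 := by
    rw [← InnerProductSpace.euclideanHausdorffMeasure_eq_volume, hP] at h3
    have hc : ((n - 1 : ℕ) : ℝ) = (n : ℝ) - 1 := by push_cast [hn]; ring
    rw [Measure.euclideanHausdorffMeasure_def, Measure.smul_apply] at h3
    rw [ENNReal.smul_def, smul_eq_mul, mul_eq_zero] at h3
    rw [← hc]
    exact h3.resolve_left (by
      simpa using Measure.addHaarScalarFactor_volume_hausdorffMeasure_ne_zero (n - 1))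
  have hiso : Isometry (fun y : s => (y : EuclideanSpace ℝ (Fin n)) + p) :=
    fun a b => by
    simp only [edist_add_right]; rfl
  rw [← hiso.hausdorffMeasure_image (Or.inl (by
    have : (1 : ℝ) ≤ n := by exact_mod_cast hn
    linarith))] at h4
  refine measure_mono_null ?_ h4
  rintro _ ⟨x, hx, rfl⟩
  have hm : (EuclideanGeometry.orthogonalProjection P x : EuclideanSpace ℝ (Fin n)) - p ∈ s :=
    AffineSubspace.vsub_mem_direction (EuclideanGeometry.orthogonalProjection P x).2 p.2
  refine ⟨⟨_, hm⟩, ?_, by simp⟩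
  have hx' := hinv x hx _ (EuclideanGeometry.orthogonalProjection_vsub_mem_direction_orthogonal P x)
  simpa using hx'

end Projection

/-! ### Functions of almost everywhere locally constant sign -/

section Sign

variable {E : Type*} [NormedAddCommGroup E] [InnerProductSpace ℝ E] [FiniteDimensional ℝ E]
  [MeasurableSpace E] [BorelSpace E]

/-- If, for each `v`, membership in `S` is almost everywhere unchanged under translation by `v` within
`B`, then `S` is null or conull in `B`. -/
theorem ae_mem_or_ae_notMem_of_translation {B S : Set E} (hB : MeasurableSet B)
    (hS : NullMeasurableSet S) (h : ∀ v : E, ∀ᵐ x, x ∈ B → x + v ∈ B → (x ∈ S ↔ x + v ∈ S)) :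
    (∀ᵐ x, x ∈ B → x ∈ S) ∨ ∀ᵐ x, x ∈ B → x ∉ S := by
  by_cases hB0 : volume B = 0
  · exact Or.inl ((measure_eq_zero_iff_ae_notMem.1 hB0).mono fun x hx hxB => absurd hxB hx)
  obtain ⟨S', hS'm, hS'⟩ := hS
  have hmem : ∀ᵐ x, (x ∈ S ↔ x ∈ S') := hS'.mem_iff
  have h' : ∀ᵐ v : E, ∀ᵐ x : E, x ∈ B → x + v ∈ B → (x ∈ S' ↔ x + v ∈ S') := by
    refine ae_of_all _ fun v => ?_
    filter_upwards [h v, hmem, (eventually_add_right_iff volume v).2 hmem] with x h1 h2 h3 h4 h5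
    rw [← h2, ← h3]
    exact h1 h4 h5
  have hmeas : MeasurableSet
      {z : E × E | z.2 ∈ B → z.2 + z.1 ∈ B → (z.2 ∈ S' ↔ z.2 + z.1 ∈ S')} := by
    have m1 : Measurable fun z : E × E => z.2 + z.1 := by fun_prop
    exact (measurable_snd hB).imp ((m1 hB).imp
      ((measurable_snd hS'm).iff (m1 hS'm)))
  have hprod := (Measure.ae_prod_iff_ae_ae (μ := (volume : Measure E)) (ν := (volume : Measure E))
    hmeas).2 h'
  have hswap := Measure.ae_ae_of_ae_prod ((Measure.measurePreserving_swap
    (μ := (volume : Measure E)) (ν := (volume : Measure E))).quasiMeasurePreserving.ae hprod)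
  obtain ⟨x, hxB, hx⟩ : ∃ x ∈ B, ∀ᵐ v : E, x ∈ B → x + v ∈ B → (x ∈ S' ↔ x + v ∈ S') := by
    by_contra hcon
    exact hB0 (measure_mono_null (fun x hxB hx => hcon ⟨x, hxB, hx⟩) hswap)
  -- for this fixed `x`, substitute `z = x + v`
  have hz : ∀ᵐ z : E, z ∈ B → (x ∈ S' ↔ z ∈ S') := by
    have := (eventually_add_left_iff volume (-x)).2 hx
    filter_upwards [this] with z hz hzB
    simpa [hxB, hzB] using hz
  by_cases hxS : x ∈ S'
  · left
    filter_upwards [hz, hmem] with z h1 h2 h3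
    exact h2.2 ((h1 h3).1 hxS)
  · right
    filter_upwards [hz, hmem] with z h1 h2 h3 h4
    exact hxS ((h1 h3).2 (h2.1 h4))

/-- On a preconnected set, two incompatible properties one of which holds almost everywhere near each
point cannot both occur. -/
theorem IsPreconnected.ae_or_ae_of_locally {Ω : Set E} (hΩ : IsPreconnected Ω) {p r : E → Prop}
    (hpr : ∀ x, ¬ (p x ∧ r x))
    (hloc : ∀ x ∈ Ω, ∃ ε > 0, (∀ᵐ y, y ∈ Metric.ball x ε → p y) ∨
      ∀ᵐ y, y ∈ Metric.ball x ε → r y) :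
    (∀ᵐ x, x ∈ Ω → p x) ∨ ∀ᵐ x, x ∈ Ω → r x := by
  have hopen : ∀ s : E → Prop, IsOpen {x | ∃ ε > 0, ∀ᵐ y, y ∈ Metric.ball x ε → s y} := by
    intro s
    rw [Metric.isOpen_iff]
    rintro x ⟨ε, hε, hx⟩
    refine ⟨ε / 2, half_pos hε, fun z hz => ⟨ε / 2, half_pos hε, ?_⟩⟩
    filter_upwards [hx] with y hy hyz
    refine hy ?_
    rw [Metric.mem_ball] at *
    linarith [dist_triangle y z x]
  have hall : ∀ s : E → Prop, Ω ⊆ {x | ∃ ε > 0, ∀ᵐ y, y ∈ Metric.ball x ε → s y} →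
      ∀ᵐ x, x ∈ Ω → s x := by
    intro s hs
    rw [ae_iff]
    refine measure_null_of_locally_null _ fun x hx => ?_
    have hxΩ : x ∈ Ω := by
      by_contra h
      exact hx fun h' => absurd h' h
    obtain ⟨ε, hε, h⟩ := hs hxΩ
    refine ⟨_, inter_mem_nhdsWithin _ (Metric.ball_mem_nhds x hε),
      measure_mono_null ?_ (ae_iff.1 h)⟩
    rintro y ⟨hy, hyb⟩ hs'
    exact hy fun _ => hs' hyb
  have hdisj : Ω ∩ ({x | ∃ ε > 0, ∀ᵐ y, y ∈ Metric.ball x ε → p y} ∩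
      {x | ∃ ε > 0, ∀ᵐ y, y ∈ Metric.ball x ε → r y}) = ∅ := by
    rw [Set.eq_empty_iff_forall_notMem]
    rintro x ⟨-, ⟨ε, hε, h1⟩, ⟨ε', hε', h2⟩⟩
    have h3 : volume (Metric.ball x (min ε ε')) = 0 := by
      rw [measure_eq_zero_iff_ae_notMem]
      filter_upwards [h1, h2] with y hy1 hy2 hy
      exact hpr y ⟨hy1 (Metric.ball_subset_ball (min_le_left _ _) hy),
        hy2 (Metric.ball_subset_ball (min_le_right _ _) hy)⟩
    exact (Metric.measure_ball_pos volume x (lt_min hε hε')).ne' h3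
  refine (isPreconnected_iff_subset_of_disjoint.1 hΩ _ _ (hopen p) (hopen r) ?_ hdisj).imp
    (hall p) (hall r)
  intro x hx
  obtain ⟨ε, hε, h⟩ := hloc x hx
  exact h.imp (fun h => ⟨ε, hε, h⟩) fun h => ⟨ε, hε, h⟩

end Sign

/-! ### Zeros and sign of the Jacobian -/

theorem pos_iff_pos_of_continuousOn_of_ne_zero {h : ℝ → ℝ} (hc : ContinuousOn h (Set.Icc 0 1))
    (h0 : ∀ τ ∈ Set.Icc (0 : ℝ) 1, h τ ≠ 0) : 0 < h 0 ↔ 0 < h 1 := by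
  constructor
  · intro hp
    by_contra! hn
    obtain ⟨τ, hτ, hz⟩ := intermediate_value_Icc' zero_le_one hc ⟨hn, hp.le⟩
    exact h0 τ hτ hz
  · intro hp
    by_contra! hn
    obtain ⟨τ, hτ, hz⟩ := intermediate_value_Icc zero_le_one hc ⟨hn, hp.le⟩
    exact h0 τ hτ hz

/-- The integral of `|J_f|^{-a}` is taken in `[0, ∞]`, with the value `∞` of the integrand where
`J_f = 0`. -/
theorem theorem1p2 (n : ℕ) (hn : 2 ≤ n) (q a : ℝ) (hq : 1 < q) (hqa : 1 ≤ (1 - 1 / q) * a)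
    (Ω : Set (EuclideanSpace ℝ (Fin n))) (hΩ : IsOpen Ω) (hΩc : IsConnected Ω)
    (f : EuclideanSpace ℝ (Fin n) → EuclideanSpace ℝ (Fin n))
    (hf : ∀ i : Fin n, MemSobolevW Ω (ENNReal.ofReal q) 2 (fun x => f x i))
    (D : EuclideanSpace ℝ (Fin n) → Matrix (Fin n) (Fin n) ℝ)
    (hD : IsWeakGradient Ω f D)
    (hJ : ∫⁻ x in Ω, (ENNReal.ofReal |preciseJacobian D x|) ^ (-a) < ⊤) :
    (∀ (P : AffineSubspace ℝ (EuclideanSpace ℝ (Fin n))) [Nonempty P],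
        Module.finrank ℝ P.direction = n - 1 →
          Measure.hausdorffMeasure ((n : ℝ) - 1)
            ((fun x => (EuclideanGeometry.orthogonalProjection P x : EuclideanSpace ℝ (Fin n))) ''
              {x | x ∈ Ω ∧ preciseJacobian D x = 0}) = 0) ∧
      ((∀ᵐ x ∂(volume.restrict Ω), 0 < preciseJacobian D x) ∨
        (∀ᵐ x ∂(volume.restrict Ω), preciseJacobian D x < 0)) := by
  have hp : 1 ≤ ENNReal.ofReal q := by
    rw [← ENNReal.ofReal_one]; exact ENNReal.ofReal_le_ofReal hq.le
  choose u hu huS using fun i => (hf i).2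
  have huL : ∀ i j, MemLp (u i j) (ENNReal.ofReal q) (volume.restrict Ω) := fun i j => (huS i j).1
  have hDu : ∀ i j, ∀ᵐ x, x ∈ Ω → D x i j = u i j x := fun i j => (hD i j).ae_eq hΩ (hu i j)
  have hJm := aemeasurable_preciseJacobian hp hΩ huL hDu
  have hline := ae_line_continuousOn_preciseJacobian_ne_zero hq hqa hΩ huS hDu hJm hJ
  have hne : ∀ v, ∀ᵐ x, ∀ t : ℝ, x + t • v ∈ Ω → preciseJacobian D (x + t • v) ≠ 0 := by
    intro v
    filter_upwards [hline v] with x hx t ht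
    have hopen : IsOpen ((fun τ : ℝ => x + τ • v) ⁻¹' Ω) := hΩ.preimage (by fun_prop)
    obtain ⟨ε, hε, hball⟩ := Metric.nhds_basis_closedBall.mem_iff.1 (hopen.mem_nhds ht)
    rw [Real.closedBall_eq_Icc] at hball
    exact (hx (t - ε) (t + ε) (by linarith) fun τ hτ => hball hτ).2 t
      ⟨by linarith, by linarith⟩
  refine ⟨fun P _ hP => ?_, ?_⟩
  · have hfin : Module.finrank ℝ P.directionᗮ = 1 := by
      have := P.direction.finrank_add_finrank_orthogonal
      rw [hP, finrank_euclideanSpace_fin] at this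
      omega
    obtain ⟨v, -, hv⟩ := finrank_eq_one_iff'.1 hfin
    set Z : Set (EuclideanSpace ℝ (Fin n)) :=
      {x | ¬ ∀ t : ℝ, x + t • (v : EuclideanSpace ℝ (Fin n)) ∈ Ω →
        preciseJacobian D (x + t • (v : EuclideanSpace ℝ (Fin n))) ≠ 0} with hZ
    refine measure_mono_null (Set.image_mono (t := Z) ?_)
      (hausdorffMeasure_orthogonalProjection_image_eq_zero (by omega) (ae_iff.1 (hne v)) P hP ?_)
    · rintro x ⟨hxΩ, hx0⟩ hx
      exact hx 0 (by simpa using hxΩ) (by simpa using hx0)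
    · intro x hx w hw
      obtain ⟨c, hc⟩ := hv ⟨w, hw⟩
      have hc' : w = c • (v : EuclideanSpace ℝ (Fin n)) := by
        rw [← Submodule.coe_smul, hc]
      -- `x` and `x + w` lie on the same line parallel to `v`
      refine fun h => hx fun t ht => ?_
      have e : x + t • (v : EuclideanSpace ℝ (Fin n)) =
          x + w + (t - c) • (v : EuclideanSpace ℝ (Fin n)) := by
        rw [hc', sub_smul]; abel
      rw [e] at ht ⊢
      exact h _ ht
  · have h0 : ∀ᵐ x, x ∈ Ω → preciseJacobian D x ≠ 0 := by
      -- the lines parallel to `v = 0` are the single points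
      filter_upwards [hne 0] with x hx hxΩ
      simpa using hx 0 (by simpa using hxΩ)
    have hS : NullMeasurableSet ({x | 0 < preciseJacobian D x} ∩ Ω) volume :=
      (nullMeasurableSet_restrict hΩ.measurableSet.nullMeasurableSet).1
        (hJm.nullMeasurable measurableSet_Ioi)
    have := hΩc.isPreconnected.ae_or_ae_of_locally
      (p := fun x => 0 < preciseJacobian D x) (r := fun x => preciseJacobian D x < 0)
      (fun x h => lt_asymm h.1 h.2) (fun x₀ hx₀ => by
        obtain ⟨ε, hε, hball⟩ := Metric.isOpen_iff.1 hΩ x₀ hx₀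
        refine ⟨ε, hε, ?_⟩
        refine (ae_mem_or_ae_notMem_of_translation (B := Metric.ball x₀ ε) measurableSet_ball hS
          fun v => ?_).imp (fun h => ?_) fun h => ?_
        · filter_upwards [hline v] with x hx hxB hxvB
          have hseg : ∀ τ ∈ Set.Icc (0 : ℝ) 1, x + τ • v ∈ Ω := fun τ hτ =>
            hball ((convex_ball x₀ ε).add_smul_mem hxB hxvB hτ)
          obtain ⟨h1, h2⟩ := hx 0 1 zero_lt_one hseg
          have := pos_iff_pos_of_continuousOn_of_ne_zero h1 h2
          simp only [zero_smul, add_zero, one_smul] at this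
          simp only [Set.mem_inter_iff, Set.mem_ofPred_eq, hball hxB, hball hxvB, and_true, this]
        · filter_upwards [h] with x hx hxB using (hx hxB).1
        · filter_upwards [h, h0] with x hx hx0 hxB
          exact lt_of_le_of_ne (not_lt.1 fun hpos => hx hxB ⟨hpos, hball hxB⟩)
            (hx0 (hball hxB)))
    exact this.imp (ae_restrict_iff' hΩ.measurableSet).2 (ae_restrict_iff' hΩ.measurableSet).2
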